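/- Let $k$ be a field, let $B$ be a finite-dimensional commutative $k$-algebra and let $A \subset B$ be a $k$-subalgebra. Let $I$ and $J$ be the nilradicals of $A$ and $B$, and put $A_{\mathrm{red}} = A/I$ and $B_{\mathrm{red}} = B/J$. Let $\mu^B$ be the unit group scheme of $B$, that is, the algebraic group with $\mu^B(R) = (B \otimes_k R)^{*}$ for every commutative $k$-algebra $R$; define $\mu^A \subset \mu^B$ likewise, and let $\mu^{B/A} = \mu^B/\mu^A$ be the quotient algebraic group (the fppf quotient sheaf). An algebraic group over $k$ is called a torus if over an algebraic closure $\bar{k}$ it becomes isomorphic to $\mathbb{G}_m^n$ for some $n \ge 0$. A finite-dimensional commutative $k$-algebra is called separable if it is étale over $k$. Consider the conditions (i) $\mu^{B/A}$ is a torus; (ii) $I = J$, and $B_{\mathrm{red}}$ is separable over $k$. Then: (a) If $\mu^{B/A}$ is a torus, then $I = J$. (b) (ii) implies (i), and (ii) also implies that $A_{\mathrm{red}}$ is separable over $k$. (c) If every ideal of $B$ that is contained in $A$ is nilpotent (equivalently, $A \subset B$ have no nonzero direct factor in common), then (i) and (ii) are equivalent. -/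

import Mathlib

open CategoryTheory AlgebraicGeometry
open scoped TensorProduct

universe u

namespace RelativeUnits

noncomputable section

/-- The structure morphism `k → Γ(X, 𝒪_X)` of the `k`-algebra of global functions on a
`k`-scheme `X`. -/
def structureHom (k : Type u) [Field k] (X : Over (Spec (.of k))) :
    k →+* Γ(X.left, ⊤) :=
  ((Scheme.ΓSpecIso (.of k)).inv ≫ X.hom.appTop).hom

/-- A morphism of `k`-schemes `X ⟶ Y` induces a homomorphism `Γ(Y, 𝒪_Y) → Γ(X, 𝒪_X)` of rings
that is compatible with the structure morphisms. -/
theorem appTop_structureHom (k : Type u) [Field k] {X Y : Over (Spec (.of k))} (f : X ⟶ Y)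
    (c : k) : f.left.appTop.hom (structureHom k Y c) = structureHom k X c := by
  have h : Y.hom.appTop ≫ f.left.appTop = X.hom.appTop := by
    rw [← Scheme.Hom.comp_appTop, Over.w f]
  simp only [structureHom, ← h]
  rfl

/-- The `k`-algebra `Γ(X, 𝒪_X)` of global functions on a `k`-scheme `X`. -/
def globalAlgebra (k : Type u) [Field k] (X : Over (Spec (.of k))) : CommAlgCat.{u} k :=
  letI := (structureHom k X).toAlgebra
  CommAlgCat.of k Γ(X.left, ⊤)

/-- A morphism `f : X ⟶ Y` of `k`-schemes induces a homomorphism `Γ(Y, 𝒪_Y) → Γ(X, 𝒪_X)` of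
`k`-algebras. -/
def globalAlgebraMap (k : Type u) [Field k] {X Y : Over (Spec (.of k))} (f : X ⟶ Y) :
    globalAlgebra k Y →ₐ[k] globalAlgebra k X where
  toRingHom := f.left.appTop.hom
  commutes' c := appTop_structureHom k f c

/-- The functor that sends a `k`-scheme `X` to the `k`-algebra `Γ(X, 𝒪_X)`. -/
def globalFunctions (k : Type u) [Field k] :
    (Over (Spec (.of k)))ᵒᵖ ⥤ CommAlgCat.{u} k where
  obj X := globalAlgebra k X.unop
  map {X Y} f := CommAlgCat.ofHom (X := globalAlgebra k X.unop) (Y := globalAlgebra k Y.unop)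
    (globalAlgebraMap k f.unop)
  map_id X := by
    refine CommAlgCat.hom_ext (AlgHom.ext fun x => ?_)
    exact congrArg (fun h => h.hom x) (Scheme.Hom.id_appTop (X := X.unop.left))
  map_comp f g := by
    refine CommAlgCat.hom_ext (AlgHom.ext fun x => ?_)
    exact congrArg (fun h => h.hom x) (Scheme.Hom.comp_appTop g.unop.left f.unop.left)

section Quotient

variable {k B : Type u} [Field k] [CommRing B] [Algebra k B] (A : Subalgebra k B)

/-- For a `k`-algebra `R`, the inclusion `μ^A(R) = (A ⊗ R)ˣ → (B ⊗ R)ˣ = μ^B(R)`. -/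
def unitsInclusion (R : Type u) [CommRing R] [Algebra k R] : (A ⊗[k] R)ˣ →* (B ⊗[k] R)ˣ :=
  Units.map (Algebra.TensorProduct.map A.val (AlgHom.id k R)).toRingHom.toMonoidHom

/-- For a homomorphism `R → S` of `k`-algebras, the map `μ^B(R) → μ^B(S)`. -/
def unitsMap (B : Type u) [CommRing B] [Algebra k B] {R S : Type u} [CommRing R] [Algebra k R]
    [CommRing S] [Algebra k S] (φ : R →ₐ[k] S) : (B ⊗[k] R)ˣ →* (B ⊗[k] S)ˣ :=
  Units.map (Algebra.TensorProduct.map (AlgHom.id k B) φ).toRingHom.toMonoidHom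

theorem range_le_comap {R S : Type u} [CommRing R] [Algebra k R]
    [CommRing S] [Algebra k S] (φ : R →ₐ[k] S) :
    (unitsInclusion A R).range ≤ (unitsInclusion A S).range.comap (unitsMap B φ) := by
  rintro _ ⟨x, rfl⟩
  refine ⟨unitsMap A φ x, Units.ext ?_⟩
  have h : (Algebra.TensorProduct.map A.val (AlgHom.id k S)).comp
      (Algebra.TensorProduct.map (AlgHom.id k A) φ) =
      (Algebra.TensorProduct.map (AlgHom.id k B) φ).comp
        (Algebra.TensorProduct.map A.val (AlgHom.id k R)) := by
    ext <;> simp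
  exact DFunLike.congr_fun h (x : A ⊗[k] R)

/-- The functor `R ↦ μ^B(R) / μ^A(R)` from `k`-algebras to abelian groups (before
sheafification). -/
def naiveQuotient : CommAlgCat.{u} k ⥤ AddCommGrpCat.{u} where
  obj R := .of (Additive ((B ⊗[k] R)ˣ ⧸ (unitsInclusion A R).range))
  map {R S} φ := AddCommGrpCat.ofHom
    (QuotientGroup.map (unitsInclusion A R).range (unitsInclusion A S).range
      (unitsMap B φ.hom) (range_le_comap A φ.hom)).toAdditive
  map_id R := by
    refine AddCommGrpCat.hom_ext (AddMonoidHom.ext fun y => ?_)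
    obtain ⟨x, rfl⟩ := QuotientGroup.mk_surjective y.toMul
    refine congrArg (fun y : (B ⊗[k] R)ˣ => Additive.ofMul (QuotientGroup.mk y)) (Units.ext ?_)
    exact DFunLike.congr_fun (Algebra.TensorProduct.map_id (R := k) (S := k) (A := B) (B := R))
      (x : B ⊗[k] R)
  map_comp {R S T} φ ψ := by
    refine AddCommGrpCat.hom_ext (AddMonoidHom.ext fun y => ?_)
    obtain ⟨x, rfl⟩ := QuotientGroup.mk_surjective y.toMul
    refine congrArg (fun y : (B ⊗[k] T)ˣ => Additive.ofMul (QuotientGroup.mk y)) (Units.ext ?_)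
    have h : Algebra.TensorProduct.map (AlgHom.id k B) (ψ.hom.comp φ.hom) =
        (Algebra.TensorProduct.map (AlgHom.id k B) ψ.hom).comp
          (Algebra.TensorProduct.map (AlgHom.id k B) φ.hom) := by
      ext <;> simp
    exact DFunLike.congr_fun h (x : B ⊗[k] R)

/-- The relative unit group `μ^{B/A} = μ^B / μ^A`, as an abelian sheaf on the big fppf site of
`Spec k`: the fppf sheafification of `X ↦ (B ⊗ Γ(X, 𝒪_X))ˣ / (A ⊗ Γ(X, 𝒪_X))ˣ`.
For `B` finite-dimensional this is the quotient of the algebraic group `μ^B` by its closed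
subgroup `μ^A`. The universe lift is there only because the site is large. -/
def relativeUnitGroup :
    Sheaf (Scheme.fppfTopology.{u}.over (Spec (.of k))) AddCommGrpCat.{u + 1} :=
  (presheafToSheaf _ _).obj
    (globalFunctions k ⋙ naiveQuotient A ⋙ AddCommGrpCat.uliftFunctor.{u + 1, u})

end Quotient

/-- The functor `R ↦ (Rˣ)ⁿ` from `K`-algebras to abelian groups. -/
def unitsPower (K : Type u) [Field K] (n : ℕ) : CommAlgCat.{u} K ⥤ AddCommGrpCat.{u} where
  obj R := .of (Fin n → Additive Rˣ)
  map {R S} φ := AddCommGrpCat.ofHom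
    ((Units.map φ.hom.toRingHom.toMonoidHom).toAdditive.compLeft (Fin n))

/-- The split torus `𝔾ₘⁿ` over the field `K`, as a functor on `K`-schemes. -/
def splitTorus (K : Type u) [Field K] (n : ℕ) :
    (Over (Spec (.of K)))ᵒᵖ ⥤ AddCommGrpCat.{u + 1} :=
  globalFunctions K ⋙ unitsPower K n ⋙ AddCommGrpCat.uliftFunctor.{u + 1, u}

/-- A commutative algebraic group `G` over `k` (given by its fppf sheaf of points on
`k`-schemes) is a torus if its base change to the algebraic closure of `k` is isomorphic, as a
group functor on schemes over the algebraic closure, to `𝔾ₘⁿ` for some `n ≥ 0`. -/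
def IsTorus {k : Type u} [Field k]
    (G : Sheaf (Scheme.fppfTopology.{u}.over (Spec (.of k))) AddCommGrpCat.{u + 1}) : Prop :=
  ∃ n : ℕ, Nonempty
    ((Over.map (Spec.map (CommRingCat.ofHom (algebraMap k (AlgebraicClosure k))))).op ⋙ G.obj ≅
      splitTorus (AlgebraicClosure k) n)

end

end RelativeUnits

/-!
Over the algebraic closure `K` of `k`, an isomorphism of `μ^{B/A}` with `𝔾ₘⁿ` amounts to natural
homomorphisms `(B ⊗ R)ˣ → (Rˣ)ⁿ` with kernel `(A ⊗ R)ˣ`. If `z` is a nilpotent element of `B ⊗ K`,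
then `1 + zX` is a unit of `B ⊗ K[X]`. Its image in the torus is constant, because the units of
`K[X]` are, hence trivial, because it is trivial at `X = 0`. So `1 + zX` lies in `A ⊗ K[X]` and `z`
in `A ⊗ K`. The nilradical of `B ⊗ K` is thus an ideal that is contained in `A ⊗ K`, so it lies in
the extension of the conductor of `A` in `B`. This gives `J ⊆ A`; and if the conductor is
contained in `J`, then `B_red` is geometrically reduced. It is also finite, because the differential
at `1` embeds `(B / A) ⊗ K` in `Kⁿ`, which makes `B / A` and the quotient of `B` by the conductor
finite.

Conversely, let `J ⊆ A` and let `B_red` be étale. Then `B ⊗ R` modulo the extension of `J` is the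
ring of `R`-valued functions on the finite set of characters `B → K`, and `A ⊗ R` consists of the
elements whose values agree at characters with the same restriction to `A`. After a base point is
chosen for each restriction, the ratios of the values at the other characters to those at the base
points identify `(B ⊗ R)ˣ / (A ⊗ R)ˣ` with `(Rˣ)ⁿ`.
-/

namespace RelativeUnits

section TensorInclusion

variable {k B : Type*} [CommRing k] [CommRing B] [Algebra k B] (A : Subalgebra k B)

/-- The inclusion `A ⊗ R → B ⊗ R`. -/
noncomputable abbrev tensorInclusion (R : Type*) [CommRing R] [Algebra k R] :
    A ⊗[k] R →ₐ[k] B ⊗[k] R :=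
  Algebra.TensorProduct.map A.val (AlgHom.id k R)

variable {R S : Type*} [CommRing R] [Algebra k R] [CommRing S] [Algebra k S]

theorem tensorInclusion_injective [Module.Flat k R] : Function.Injective (tensorInclusion A R) :=
  Module.Flat.rTensor_preserves_injective_linearMap (M := R) A.val.toLinearMap
    Subtype.val_injective

theorem mem_range_tensorInclusion_iff_rTensor_mkQ {z : B ⊗[k] R} :
    z ∈ (tensorInclusion A R).range ↔ (Subalgebra.toSubmodule A).mkQ.rTensor R z = 0 :=
  (rTensor_exact R (LinearMap.exact_subtype_mkQ (Subalgebra.toSubmodule A))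
    (Submodule.mkQ_surjective _) z).symm

theorem lTensor_mem_range_tensorInclusion (f : R →ₗ[k] S) {z : B ⊗[k] R}
    (hz : z ∈ (tensorInclusion A R).range) : f.lTensor B z ∈ (tensorInclusion A S).range := by
  rw [mem_range_tensorInclusion_iff_rTensor_mkQ] at hz ⊢
  rw [← LinearMap.comp_apply, LinearMap.rTensor_comp_lTensor, ← LinearMap.lTensor_comp_rTensor,
    LinearMap.comp_apply, hz, map_zero]

theorem repr_baseChange_mem {ι : Type*} (c : Module.Basis ι k R) {z : B ⊗[k] R}
    (hz : z ∈ (tensorInclusion A R).range) (i : ι) : (c.baseChange B).repr z i ∈ A := by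
  obtain ⟨y, rfl⟩ := hz
  induction y with
  | zero => simp
  | add x y hx hy => rw [map_add, map_add, Finsupp.add_apply]; exact A.add_mem hx hy
  | tmul a r => simpa using A.smul_mem a.2 (c.repr r i)

variable (R) in
theorem map_subset_range_tensorInclusion {𝔞 : Ideal B} (h𝔞 : (𝔞 : Set B) ⊆ A) :
    (𝔞.map (algebraMap B (B ⊗[k] R)) : Set (B ⊗[k] R)) ⊆ (tensorInclusion A R).range := by
  intro z hz
  obtain ⟨y, rfl⟩ : z ∈ LinearMap.range ((𝔞.restrictScalars k).subtype.rTensor R) := by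
    rw [← Ideal.map_includeLeft_eq]
    exact hz
  have hzero : (Subalgebra.toSubmodule A).mkQ ∘ₗ (𝔞.restrictScalars k).subtype = 0 :=
    LinearMap.ext fun b => (Submodule.Quotient.mk_eq_zero _).mpr (h𝔞 b.2)
  rw [SetLike.mem_coe, mem_range_tensorInclusion_iff_rTensor_mkQ, ← LinearMap.rTensor_comp_apply,
    hzero, LinearMap.rTensor_zero, LinearMap.zero_apply]

end TensorInclusion

section Conductor

variable {k B : Type*} [CommRing k] [CommRing B] [Algebra k B] (A : Subalgebra k B)

/-- The conductor of `A` in `B`: the largest ideal of `B` that is contained in `A`. -/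
def conductorIdeal : Ideal B where
  carrier := {b | ∀ c, b * c ∈ A}
  zero_mem' c := by simp
  add_mem' ha hb c := by rw [add_mul]; exact A.add_mem (ha c) (hb c)
  smul_mem' c b hb d := by
    rw [smul_eq_mul, mul_comm c b, mul_assoc]
    exact hb _

theorem conductorIdeal_subset : (conductorIdeal A : Set B) ⊆ A := fun b hb => by simpa using hb 1

theorem le_map_conductorIdeal_of_subset {R : Type*} [CommRing R] [Algebra k R] [Module.Free k R]
    {𝔟 : Ideal (B ⊗[k] R)} (h𝔟 : (𝔟 : Set (B ⊗[k] R)) ⊆ (tensorInclusion A R).range) :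
    𝔟 ≤ (conductorIdeal A).map (algebraMap B (B ⊗[k] R)) := by
  intro z hz
  let c := (Module.Free.chooseBasis k R).baseChange B
  have hcoord (i) : c.repr z i ∈ conductorIdeal A := fun b => by
    have := repr_baseChange_mem A (Module.Free.chooseBasis k R)
      (h𝔟 (𝔟.mul_mem_left (algebraMap B (B ⊗[k] R) b) hz)) i
    rwa [← Algebra.smul_def, map_smul, Finsupp.smul_apply, smul_eq_mul, mul_comm] at this
  rw [← c.linearCombination_repr z, Finsupp.linearCombination_apply]
  refine Ideal.sum_mem _ fun i _ => ?_
  simp only [Algebra.smul_def]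
  exact Ideal.mul_mem_right _ _ (Ideal.mem_map_of_mem _ (hcoord i))

theorem mem_conductorIdeal_of_mul_mem {ι : Type*} (b : ι → B)
    (hb : Submodule.span k (Set.range ((Subalgebra.toSubmodule A).mkQ ∘ b)) = ⊤) {x : B}
    (hx : x ∈ A) (hxb : ∀ i, x * b i ∈ A) : x ∈ conductorIdeal A := by
  intro c
  have hle : (⊤ : Submodule k (B ⧸ Subalgebra.toSubmodule A)) ≤
      ((Subalgebra.toSubmodule A).comap (LinearMap.mulLeft k x)).map
        (Subalgebra.toSubmodule A).mkQ := by
    rw [← hb, Submodule.span_le, Set.range_subset_iff]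
    exact fun i => ⟨b i, hxb i, rfl⟩
  obtain ⟨d, hd, hdc⟩ := hle (Submodule.mem_top (x := (Subalgebra.toSubmodule A).mkQ c))
  have hcd : c - d ∈ A := (Submodule.Quotient.eq _).mp hdc.symm
  have := A.add_mem (A.mul_mem hx hcd) hd
  rwa [LinearMap.mulLeft_apply, ← mul_add, sub_add_cancel] at this

theorem finite_quotient_conductorIdeal [IsNoetherianRing k]
    [Module.Finite k (B ⧸ Subalgebra.toSubmodule A)] : Module.Finite k (B ⧸ conductorIdeal A) := by
  obtain ⟨n, q, hq⟩ := Module.Finite.exists_fin (R := k) (M := B ⧸ Subalgebra.toSubmodule A)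
  choose b hb using fun i => (Subalgebra.toSubmodule A).mkQ_surjective (q i)
  let Φ : B →ₗ[k] (Option (Fin n) → B ⧸ Subalgebra.toSubmodule A) :=
    LinearMap.pi fun i => (Subalgebra.toSubmodule A).mkQ ∘ₗ LinearMap.mulRight k (i.elim 1 b)
  have hΦ (x : B) : Φ x = 0 ↔ x ∈ conductorIdeal A := by
    have hmem (c : B) : (Subalgebra.toSubmodule A).mkQ (x * c) = 0 ↔ x * c ∈ A :=
      Submodule.Quotient.mk_eq_zero _
    refine ⟨fun h => ?_, fun h => funext fun i => (hmem _).mpr (h _)⟩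
    refine mem_conductorIdeal_of_mul_mem A b (by rwa [show _ ∘ b = q from funext hb]) ?_
      fun i => (hmem _).mp (congrFun h (some i))
    simpa using (hmem 1).mp (congrFun h none)
  let Ψ : (B ⧸ (conductorIdeal A).restrictScalars k) →ₗ[k] _ :=
    ((conductorIdeal A).restrictScalars k).liftQ Φ fun x hx => (hΦ x).mpr hx
  have hΨ : Function.Injective Ψ :=
    LinearMap.ker_eq_bot.mp (Submodule.ker_liftQ_eq_bot _ _ _ fun x hx => (hΦ x).mp hx)
  exact Module.Finite.of_injective Ψ hΨ

end Conductor

section Nilradical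

theorem map_nilradical_le {B C : Type*} [CommRing B] [CommRing C] (f : B →+* C) :
    (nilradical B).map f ≤ nilradical C :=
  Ideal.map_le_iff_le_comap.mpr fun _ hb => (mem_nilradical.mp hb).map f

variable {k B : Type*} [CommRing k] [CommRing B] [Algebra k B]

theorem comap_val_nilradical (A : Subalgebra k B) : (nilradical B).comap A.val = nilradical A :=
  Ideal.ext fun _ => IsNilpotent.map_iff (f := A.val) Subtype.val_injective

theorem image_val_nilradical_eq_iff {A : Subalgebra k B} :
    Subtype.val '' (nilradical A : Set A) = (nilradical B : Set B) ↔
      (nilradical B : Set B) ⊆ A := by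
  have himage := Set.image_preimage_eq_iff (f := ((↑) : A → B)) (s := (nilradical B : Set B))
  rw [Subtype.range_coe] at himage
  rw [← comap_val_nilradical]
  exact himage

variable {R : Type*} [CommRing R] [Algebra k R]

theorem ker_map_quotientMkₐ_id (𝔞 : Ideal B) :
    RingHom.ker (Algebra.TensorProduct.map (Ideal.Quotient.mkₐ k 𝔞) (AlgHom.id k R)) =
      𝔞.map (algebraMap B (B ⊗[k] R)) := by
  rw [Algebra.TensorProduct.rTensor_ker _ (Ideal.Quotient.mkₐ_surjective k 𝔞)]
  exact congrArg _ (Ideal.Quotient.mkₐ_ker k 𝔞)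

theorem map_quotientMkₐ_id_surjective (𝔞 : Ideal B) : Function.Surjective
    (Algebra.TensorProduct.map (Ideal.Quotient.mkₐ k 𝔞) (AlgHom.id k R)) :=
  TensorProduct.map_surjective (Ideal.Quotient.mkₐ_surjective k 𝔞) Function.surjective_id

theorem isReduced_quotient_nilradical_tensorProduct
    (h : nilradical (B ⊗[k] R) ≤ (nilradical B).map (algebraMap B (B ⊗[k] R))) :
    IsReduced ((B ⧸ nilradical B) ⊗[k] R) := by
  let q := Algebra.TensorProduct.map (Ideal.Quotient.mkₐ k (nilradical B)) (AlgHom.id k R)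
  have hker : RingHom.ker q = (nilradical B).map (algebraMap B (B ⊗[k] R)) :=
    ker_map_quotientMkₐ_id _
  refine ⟨fun w ⟨n, hn⟩ => ?_⟩
  obtain ⟨z, rfl⟩ := map_quotientMkₐ_id_surjective _ w
  have hzn : z ^ n ∈ RingHom.ker q := (map_pow q z n).trans hn
  have hz : IsNilpotent z := (mem_nilradical.mp (map_nilradical_le _ (hker.le hzn))).of_pow
  exact hker.ge (h hz)

end Nilradical

section Etale

theorem etale_of_isReduced (K C : Type u) [Field K] [PerfectField K] [CommRing C] [Algebra K C]
    [Module.Finite K C] [IsReduced C] : Algebra.Etale K C := by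
  have : IsArtinianRing C := isArtinian_of_tower K inferInstance
  let _ (m : MaximalSpectrum C) : Field (C ⧸ m.asIdeal) := Ideal.Quotient.field m.asIdeal
  exact (Algebra.Etale.iff_exists_algEquiv_prod K C).mpr ⟨MaximalSpectrum C, inferInstance,
    fun m => C ⧸ m.asIdeal, fun _ => inferInstance, fun _ => inferInstance,
    (IsArtinianRing.equivPi C).restrictScalars K, fun _ => ⟨inferInstance, inferInstance⟩⟩

variable {k C D : Type u} [Field k] [CommRing C] [Algebra k C] [CommRing D] [Algebra k D]

theorem etale_iff_isGeometricallyReduced [Module.Finite k C] :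
    Algebra.Etale k C ↔ Algebra.IsGeometricallyReduced k C := by
  rw [Algebra.isGeometricallyReduced_field_iff]
  constructor
  · intro
    exact Algebra.FormallyUnramified.isReduced_of_field (AlgebraicClosure k) _
  · intro
    have := etale_of_isReduced (AlgebraicClosure k) (AlgebraicClosure k ⊗[k] C)
    exact Algebra.Etale.of_etale_tensorProduct_of_faithfullyFlat (AlgebraicClosure k)

theorem etale_of_injective [Algebra.Etale k D] (f : C →ₐ[k] D) (hf : Function.Injective f) :
    Algebra.Etale k C := by
  have : Module.Finite k D := Algebra.FormallyUnramified.finite_of_free k D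
  have : Module.Finite k C := Module.Finite.of_injective f.toLinearMap hf
  have := etale_iff_isGeometricallyReduced.mp ‹Algebra.Etale k D›
  exact etale_iff_isGeometricallyReduced.mpr (.of_injective f hf)

end Etale

section Evaluation

variable {k K C : Type*} [CommRing k] [CommRing K] [Algebra k K] [CommRing C] [Algebra k C]

/-- The value of `C ⊗ R` at a character `χ : C → K`, where `R` is a `K`-algebra. -/
noncomputable def evalAt (R : Type*) [CommRing R] [Algebra k R] [Algebra K R]
    [IsScalarTower k K R] (χ : C →ₐ[k] K) : C ⊗[k] R →ₐ[k] R :=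
  Algebra.TensorProduct.lift ((IsScalarTower.toAlgHom k K R).comp χ) (AlgHom.id k R)
    fun _ _ => Commute.all _ _

section

variable {R : Type*} [CommRing R] [Algebra k R] [Algebra K R] [IsScalarTower k K R]

@[simp]
theorem evalAt_tmul (χ : C →ₐ[k] K) (c : C) (r : R) :
    evalAt R χ (c ⊗ₜ r) = algebraMap K R (χ c) * r := by
  simp [evalAt]

theorem evalAt_map_right {S : Type*} [CommRing S] [Algebra k S] [Algebra K S]
    [IsScalarTower k K S] (χ : C →ₐ[k] K) (φ : R →ₐ[K] S) (z : C ⊗[k] R) :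
    evalAt S χ (Algebra.TensorProduct.map (AlgHom.id k C) (φ.restrictScalars k) z) =
      φ (evalAt R χ z) := by
  refine DFunLike.congr_fun (f := (evalAt S χ).comp (Algebra.TensorProduct.map _ _))
    (g := (φ.restrictScalars k).comp (evalAt R χ)) ?_ z
  ext <;> simp

theorem evalAt_map_left {D : Type*} [CommRing D] [Algebra k D] (χ : D →ₐ[k] K) (f : C →ₐ[k] D)
    (z : C ⊗[k] R) :
    evalAt R χ (Algebra.TensorProduct.map f (AlgHom.id k R) z) = evalAt R (χ.comp f) z := by
  refine DFunLike.congr_fun (f := (evalAt R χ).comp (Algebra.TensorProduct.map _ _))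
    (g := evalAt R (χ.comp f)) ?_ z
  ext <;> simp

end

variable (K C)

/-- The values of `C ⊗ R` at all characters `C → K`, where `R` is a `K`-algebra. -/
noncomputable def evalAll (R : Type*) [CommRing R] [Algebra k R] [Algebra K R]
    [IsScalarTower k K R] : C ⊗[k] R →ₐ[k] ((C →ₐ[k] K) → R) :=
  AlgHom.pi (evalAt R)

/-- The values of the `K`-algebra `K ⊗ C` at all characters `C → K`. -/
noncomputable def evalBaseChange : K ⊗[k] C →ₐ[K] ((C →ₐ[k] K) → K) :=
  AlgHom.pi fun χ => Algebra.TensorProduct.lift (Algebra.ofId K K) χ fun _ _ => Commute.all _ _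

/-- A character with values in a reduced ring kills nilpotents, so it factors through the
reduction. -/
noncomputable def reductionCharacter [IsReduced K] : (C →ₐ[k] K) ≃ (C ⧸ nilradical C →ₐ[k] K) where
  toFun χ := Ideal.Quotient.liftₐ (nilradical C) χ fun _ hc =>
    ((mem_nilradical.mp hc).map χ).eq_zero
  invFun ψ := ψ.comp (Ideal.Quotient.mkₐ k (nilradical C))
  left_inv _ := rfl
  right_inv _ := Ideal.Quotient.algHom_ext k rfl

theorem evalAll_apply_eq_evalAll_reduction [IsReduced K] (R : Type*) [CommRing R] [Algebra k R]
    [Algebra K R] [IsScalarTower k K R] (z : C ⊗[k] R) (χ : C →ₐ[k] K) :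
    evalAll K C R z χ = evalAll K (C ⧸ nilradical C) R
      (Algebra.TensorProduct.map (Ideal.Quotient.mkₐ k (nilradical C)) (AlgHom.id k R) z)
      (reductionCharacter K C χ) :=
  (evalAt_map_left (reductionCharacter K C χ) (Ideal.Quotient.mkₐ k (nilradical C)) z).symm

end Evaluation

section EtaleEvaluation

variable {k : Type*} (K C : Type*) [Field k] [Field K] [IsSepClosed K] [Algebra k K] [CommRing C]
  [Algebra k C]

theorem evalBaseChange_injective [Algebra.Etale k C] :
    Function.Injective (evalBaseChange (k := k) K C) := by
  obtain ⟨n, ⟨e⟩⟩ := Algebra.IsFiniteSplit.nonempty_algEquiv_fun K (K ⊗[k] C)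
  refine (injective_iff_map_eq_zero _).mpr fun z hz => ?_
  refine e.map_eq_zero_iff.mp (funext fun i => ?_)
  let ψ : K ⊗[k] C →ₐ[K] K := (Pi.evalAlgHom K (fun _ => K) i).comp e
  let χ : C →ₐ[k] K := (ψ.restrictScalars k).comp Algebra.TensorProduct.includeRight
  have hψ : Algebra.TensorProduct.lift (Algebra.ofId K K) χ (fun _ _ => Commute.all _ _) = ψ := by
    ext
    simp [χ]
  exact (DFunLike.congr_fun hψ z).symm.trans (congrFun hz χ)

theorem evalBaseChange_bijective [Algebra.Etale k C] :
    Function.Bijective (evalBaseChange (k := k) K C) := by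
  have : Module.Finite k C := Algebra.FormallyUnramified.finite_of_free k C
  have := Fintype.ofFinite (C →ₐ[k] K)
  have hinj := evalBaseChange_injective (k := k) K C
  have hle : Module.finrank K ((C →ₐ[k] K) → K) ≤ Module.finrank K (K ⊗[k] C) := by
    rw [Module.finrank_fintype_fun_eq_card, Module.finrank_baseChange, ← Nat.card_eq_fintype_card]
    exact card_algHom_le_finrank k C K
  have hge := LinearMap.finrank_le_finrank_of_injective
    (f := (evalBaseChange (k := k) K C).toLinearMap) hinj
  exact ⟨hinj, (LinearMap.injective_iff_surjective_of_finrank_eq_finrank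
    (f := (evalBaseChange (k := k) K C).toLinearMap) (hge.antisymm hle)).mp hinj⟩

variable (R : Type*) [CommRing R] [Algebra k R] [Algebra K R] [IsScalarTower k K R]

theorem evalAll_bijective_of_etale [Algebra.Etale k C] :
    Function.Bijective (evalAll (k := k) K C R) := by
  classical
  have : Module.Finite k C := Algebra.FormallyUnramified.finite_of_free k C
  have := Fintype.ofFinite (C →ₐ[k] K)
  let e : C ⊗[k] R ≃ₐ[k] ((C →ₐ[k] K) → R) :=
    (Algebra.TensorProduct.comm k C R).trans <|
      ((Algebra.TensorProduct.cancelBaseChange k K K R C).symm.trans <|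
        (Algebra.TensorProduct.congr AlgEquiv.refl
          (AlgEquiv.ofBijective _ (evalBaseChange_bijective K C))).trans <|
            Algebra.TensorProduct.piScalarRight K K R _).restrictScalars k
  have he : evalAll (k := k) K C R = e := by
    ext c χ
    · simp [e, evalAll, evalBaseChange, Algebra.smul_def]
    · have hone : evalBaseChange (k := k) K C (1 ⊗ₜ 1) χ = 1 :=
        congrFun (map_one (evalBaseChange (k := k) K C)) χ
      simp [e, evalAll, hone]
  exact he ▸ e.bijective

variable [Algebra.Etale k (C ⧸ nilradical C)]

theorem evalAll_surjective : Function.Surjective (evalAll (k := k) K C R) := by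
  intro g
  obtain ⟨w, hw⟩ := (evalAll_bijective_of_etale K (C ⧸ nilradical C) R).2
    (g ∘ (reductionCharacter K C).symm)
  obtain ⟨z, rfl⟩ := map_quotientMkₐ_id_surjective _ w
  refine ⟨z, funext fun χ => ?_⟩
  rw [evalAll_apply_eq_evalAll_reduction]
  refine (congrFun hw _).trans ?_
  rw [Function.comp_apply, Equiv.symm_apply_apply]

theorem ker_evalAll : RingHom.ker (evalAll (k := k) K C R) =
    (nilradical C).map (algebraMap C (C ⊗[k] R)) := by
  rw [← ker_map_quotientMkₐ_id]
  ext z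
  rw [RingHom.mem_ker, RingHom.mem_ker,
    ← map_eq_zero_iff _ (evalAll_bijective_of_etale K (C ⧸ nilradical C) R).1,
    ← (reductionCharacter K C).surjective.injective_comp_right.eq_iff]
  exact Eq.congr_left (funext fun χ => evalAll_apply_eq_evalAll_reduction K C R z χ)

end EtaleEvaluation

section Units

theorem units_map_surjective_of_ker_le_nilradical {S T : Type*} [CommRing S] [CommRing T]
    {f : S →+* T} (hf : Function.Surjective f) (hker : RingHom.ker f ≤ nilradical S) :
    Function.Surjective (Units.map f.toMonoidHom) := by
  intro u
  obtain ⟨x, hx⟩ := hf u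
  obtain ⟨y, hy⟩ := hf ↑u⁻¹
  have hxy : IsNilpotent (x * y - 1) := hker (by simp [RingHom.mem_ker, hx, hy])
  have hx_unit : IsUnit x := isUnit_of_mul_isUnit_left (by simpa using hxy.isUnit_add_one)
  exact ⟨hx_unit.unit, Units.ext hx⟩

/-- The values of a unit of `C ⊗ R` at all characters `C → K`, where `R` is a `K`-algebra. -/
noncomputable def evalUnits {k : Type*} (K C R : Type*) [CommRing k] [CommRing K] [Algebra k K]
    [CommRing C] [Algebra k C] [CommRing R] [Algebra k R] [Algebra K R] [IsScalarTower k K R] :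
    (C ⊗[k] R)ˣ →* ((C →ₐ[k] K) → Rˣ) :=
  MulEquiv.piUnits.toMonoidHom.comp
    (Units.map (evalAll (k := k) K C R).toRingHom.toMonoidHom)

theorem evalUnits_surjective {k : Type*} (K C R : Type*) [Field k] [Field K] [IsSepClosed K]
    [Algebra k K] [CommRing C] [Algebra k C] [CommRing R] [Algebra k R] [Algebra K R]
    [IsScalarTower k K R] [Algebra.Etale k (C ⧸ nilradical C)] :
    Function.Surjective (evalUnits (k := k) K C R) := by
  intro g
  obtain ⟨u, hu⟩ := units_map_surjective_of_ker_le_nilradical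
    (f := (evalAll (k := k) K C R).toRingHom) (evalAll_surjective K C R)
    ((ker_evalAll K C R).le.trans (map_nilradical_le _)) (MulEquiv.piUnits.symm g)
  refine ⟨u, funext fun χ => Units.ext ?_⟩
  exact congrFun (congrArg Units.val hu) χ

end Units

section Fibers

variable {X Y : Type*} (f : X → Y)

/-- A chosen base point of the fibre of `f` through `x`. -/
noncomputable def fiberBase (x : X) : X :=
  Set.rangeSplitting f (Set.rangeFactorization f x)

theorem apply_fiberBase (x : X) : f (fiberBase f x) = f x :=
  Set.apply_rangeSplitting f _

variable {f} in
theorem fiberBase_eq_fiberBase {x y : X} (h : f x = f y) : fiberBase f x = fiberBase f y :=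
  congrArg (Set.rangeSplitting f) (Subtype.ext h)

theorem factorsThrough_iff_apply_fiberBase {Z : Type*} {g : X → Z} :
    g.FactorsThrough f ↔ ∀ x, g (fiberBase f x) = g x := by
  refine ⟨fun h x => h (apply_fiberBase f x), fun h x y hxy => ?_⟩
  rw [← h x, ← h y, fiberBase_eq_fiberBase hxy]

variable (G : Type*) [CommGroup G]

/-- The ratios `g x / g x₀`, where `x` runs through the points that differ from the base point `x₀`
of their fibre. They split the subgroup of functions that are constant on the fibres. -/
noncomputable def fiberRatio : (X → G) →* ({x // fiberBase f x ≠ x} → G) where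
  toFun g x := g x / g (fiberBase f x)
  map_one' := by ext; simp
  map_mul' g h := by ext; simp [mul_div_mul_comm]

variable {G}

theorem fiberRatio_eq_one_iff {g : X → G} : fiberRatio f G g = 1 ↔ g.FactorsThrough f := by
  rw [factorsThrough_iff_apply_fiberBase]
  refine ⟨fun h x => ?_, fun h => funext fun x => div_eq_one.mpr (h x).symm⟩
  by_cases hx : fiberBase f x = x
  · rw [hx]
  · exact (div_eq_one.mp (congrFun h ⟨x, hx⟩)).symm

variable (G) in
theorem fiberRatio_surjective : Function.Surjective (fiberRatio f G) := by
  classical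
  intro h
  refine ⟨fun x => if hx : fiberBase f x ≠ x then h ⟨x, hx⟩ else 1, funext fun x => ?_⟩
  have hbase : fiberBase f (fiberBase f x) = fiberBase f x :=
    fiberBase_eq_fiberBase (apply_fiberBase f x)
  simp [fiberRatio, x.2, hbase]

theorem fiberRatio_comp {H : Type*} [CommGroup H] (φ : G →* H) (g : X → G) :
    fiberRatio f H (φ ∘ g) = φ ∘ fiberRatio f G g := by
  ext
  simp [fiberRatio]

end Fibers

section Membership

variable {k B : Type u} [Field k] [CommRing B] [Algebra k B] (A : Subalgebra k B)

theorem etale_quotient_nilradical_subalgebra [Algebra.Etale k (B ⧸ nilradical B)] :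
    Algebra.Etale k (A ⧸ nilradical A) := by
  have hcomap := comap_val_nilradical A
  exact etale_of_injective (Ideal.quotientMapₐ (nilradical B) A.val hcomap.ge)
    (Ideal.quotientMap_injective' (H := hcomap.ge) hcomap.le)

variable {A} in
theorem mem_range_tensorInclusion_of_factorsThrough (K : Type u) [Field K] [IsSepClosed K]
    [Algebra k K] {R : Type*} [CommRing R] [Algebra k R] [Algebra K R] [IsScalarTower k K R]
    [Algebra.Etale k (B ⧸ nilradical B)] (hA : (nilradical B : Set B) ⊆ A) {z : B ⊗[k] R}
    (hz : (evalAll K B R z).FactorsThrough fun χ => χ.comp A.val) :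
    z ∈ (tensorInclusion A R).range := by
  have := etale_quotient_nilradical_subalgebra A
  obtain ⟨g, hg⟩ := (Function.factorsThrough_iff _).mp hz
  obtain ⟨y, hy⟩ := evalAll_surjective K A R g
  have hdiff : z - tensorInclusion A R y ∈ RingHom.ker (evalAll (k := k) K B R) := by
    rw [RingHom.mem_ker, map_sub, sub_eq_zero, hg]
    refine funext fun χ => (congrFun hy _).symm.trans ?_
    exact (evalAt_map_left χ A.val y).symm
  rw [ker_evalAll] at hdiff
  simpa using add_mem (map_subset_range_tensorInclusion A R hA hdiff)
    (AlgHom.mem_range_self (tensorInclusion A R) y)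

theorem mem_range_unitsInclusion_iff {R : Type u} [CommRing R] [Algebra k R] {u : (B ⊗[k] R)ˣ} :
    u ∈ (unitsInclusion A R).range ↔
      (u : B ⊗[k] R) ∈ (tensorInclusion A R).range ∧
        (↑u⁻¹ : B ⊗[k] R) ∈ (tensorInclusion A R).range := by
  constructor
  · rintro ⟨a, rfl⟩
    exact ⟨⟨a, rfl⟩, ⟨↑a⁻¹, rfl⟩⟩
  · rintro ⟨⟨y, hy⟩, ⟨y', hy'⟩⟩
    have hyy' : y * y' = 1 := tensorInclusion_injective A (by
      rw [map_mul, map_one]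
      exact (congrArg₂ (· * ·) hy hy').trans u.mul_inv)
    exact ⟨.mkOfMulEqOne y y' hyy', Units.ext hy⟩

variable {A} in
theorem mem_range_unitsInclusion_iff_factorsThrough (K : Type u) [Field K] [IsSepClosed K]
    [Algebra k K] {R : Type u} [CommRing R] [Algebra k R] [Algebra K R] [IsScalarTower k K R]
    [Algebra.Etale k (B ⧸ nilradical B)] (hA : (nilradical B : Set B) ⊆ A) {u : (B ⊗[k] R)ˣ} :
    u ∈ (unitsInclusion A R).range ↔
      (evalUnits K B R u).FactorsThrough fun χ => χ.comp A.val := by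
  constructor
  · rintro ⟨a, rfl⟩ χ ψ hχψ
    refine Units.ext ?_
    exact (evalAt_map_left χ A.val (a : A ⊗[k] R)).trans <|
      (congrArg (evalAt R · (a : A ⊗[k] R)) hχψ).trans (evalAt_map_left ψ A.val _).symm
  · intro h
    refine (mem_range_unitsInclusion_iff A).mpr
      ⟨mem_range_tensorInclusion_of_factorsThrough K hA fun _ _ hχψ => ?_,
        mem_range_tensorInclusion_of_factorsThrough K hA fun χ ψ hχψ => ?_⟩
    · exact congrArg Units.val (h hχψ)
    · refine congrArg Units.val (?_ : evalUnits K B R u⁻¹ χ = evalUnits K B R u⁻¹ ψ)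
      rw [map_inv, Pi.inv_apply, Pi.inv_apply, h hχψ]

end Membership

section Sections

/-- The functor of points of the affine line. -/
def sectionsFunctor : Scheme.{u}ᵒᵖ ⥤ Type u := Scheme.Γ ⋙ forget CommRingCat

theorem isSheaf_sectionsFunctor :
    Presheaf.IsSheaf Scheme.fppfTopology.{u} sectionsFunctor.{u} := by
  have e : sectionsFunctor.{u}.RepresentableBy (Spec (.of (MvPolynomial PUnit (ULift.{u} ℤ)))) :=
    { homEquiv := fun {X} => (AffineSpace.toSpecMvPolyIntEquiv PUnit).trans
        (Equiv.funUnique PUnit _)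
      homEquiv_comp := fun f g => rfl }
  have := e.isRepresentable
  rw [isSheaf_iff_isSheaf_of_type]
  exact GrothendieckTopology.Subcanonical.isSheaf_of_isRepresentable _

variable {k : Type u} [Field k]

theorem isSheaf_sections_over :
    Presieve.IsSheaf (Scheme.fppfTopology.{u}.over (Spec (.of k)))
      ((Over.forget _).op ⋙ sectionsFunctor) := by
  rw [← isSheaf_iff_isSheaf_of_type]
  exact (Over.forget _).op_comp_isSheaf_of_isSheaf _ Scheme.fppfTopology.{u} _
    isSheaf_sectionsFunctor

variable {X : Over (Spec (.of k))} {S : Sieve X}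

theorem section_ext (hS : S ∈ Scheme.fppfTopology.{u}.over (Spec (.of k)) X)
    {a b : globalAlgebra k X}
    (h : ∀ ⦃Y : Over (Spec (.of k))⦄ (f : Y ⟶ X), S f →
      globalAlgebraMap k f a = globalAlgebraMap k f b) : a = b :=
  (isSheaf_sections_over.isSeparated S hS).ext h

theorem section_glue (hS : S ∈ Scheme.fppfTopology.{u}.over (Spec (.of k)) X)
    (x : ∀ ⦃Y : Over (Spec (.of k))⦄ (f : Y ⟶ X), S f → globalAlgebra k Y)
    (hx : ∀ ⦃Y Z : Over (Spec (.of k))⦄ (f : Y ⟶ X) (g : Z ⟶ Y) (hf : S f),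
      globalAlgebraMap k g (x f hf) = x (g ≫ f) (S.downward_closed hf g)) :
    ∃ a : globalAlgebra k X, ∀ ⦃Y : Over (Spec (.of k))⦄ (f : Y ⟶ X) (hf : S f),
      globalAlgebraMap k f a = x f hf := by
  have hcompatible : Presieve.FamilyOfElements.Compatible
      (P := (Over.forget _).op ⋙ sectionsFunctor) (R := S.arrows) x :=
    (Presieve.compatible_iff_sieveCompatible _).mpr fun Y Z f g hf => (hx f g hf).symm
  exact (isSheaf_sections_over S hS _ hcompatible).exists

theorem equivFinsuppOfBasisLeft_lTensor {V M N ι : Type*} [AddCommGroup V] [Module k V]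
    [AddCommGroup M] [Module k M] [AddCommGroup N] [Module k N] [DecidableEq ι]
    (c : Module.Basis ι k V) (f : M →ₗ[k] N) (z : V ⊗[k] M) (i : ι) :
    TensorProduct.equivFinsuppOfBasisLeft c (f.lTensor V z) i =
      f (TensorProduct.equivFinsuppOfBasisLeft c z i) := by
  induction z with
  | zero => simp
  | add z w hz hw => simp only [map_add, Finsupp.add_apply, hz, hw]
  | tmul v m => simp

theorem lTensor_ext (hS : S ∈ Scheme.fppfTopology.{u}.over (Spec (.of k)) X)
    {V : Type*} [AddCommGroup V] [Module k V] {z : V ⊗[k] globalAlgebra k X}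
    (h : ∀ ⦃Y : Over (Spec (.of k))⦄ (f : Y ⟶ X), S f →
      (globalAlgebraMap k f).toLinearMap.lTensor V z = 0) : z = 0 := by
  classical
  let c := Module.Basis.ofVectorSpace k V
  refine (TensorProduct.equivFinsuppOfBasisLeft c).map_eq_zero_iff.mp (Finsupp.ext fun i => ?_)
  refine section_ext hS fun Y f hYf => ?_
  have hf := equivFinsuppOfBasisLeft_lTensor c (globalAlgebraMap k f).toLinearMap z i
  rw [h f hYf, map_zero] at hf
  exact hf.symm.trans (map_zero _).symm

end Sections

section Torus

variable {K : Type u} [Field K] {n : ℕ} {X Y : Over (Spec (.of K))}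

/-- The coordinates of a point of the split torus. -/
def torusCoord (x : (splitTorus K n).obj (.op X)) (i : Fin n) : (globalAlgebra K X)ˣ :=
  (x.down i).toMul

theorem torusCoord_map (f : Y ⟶ X) (x : (splitTorus K n).obj (.op X)) (i : Fin n) :
    (torusCoord ((splitTorus K n).map f.op x) i : globalAlgebra K Y) =
      globalAlgebraMap K f (torusCoord x i : globalAlgebra K X) :=
  rfl

theorem splitTorus_ext {x y : (splitTorus K n).obj (.op X)}
    (h : ∀ i, (torusCoord x i : globalAlgebra K X) = torusCoord y i) : x = y :=
  ULift.ext _ _ (funext fun i => Additive.toMul.injective (Units.ext (h i)))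

variable (K n)

theorem isSheaf_splitTorus :
    Presheaf.IsSheaf (Scheme.fppfTopology.{u}.over (Spec (.of K))) (splitTorus K n) := by
  refine Presheaf.isSheaf_of_isSheaf_comp _ _ (forget AddCommGrpCat.{u + 1}) ?_
  rw [isSheaf_iff_isSheaf_of_type]
  intro X S hS x hx
  rw [Presieve.compatible_iff_sieveCompatible] at hx
  let y ⦃Y : Over (Spec (.of K))⦄ (f : Y ⟶ X) (hf : S f) : (splitTorus K n).obj (.op Y) := x f hf
  have hy ⦃Y Z : Over (Spec (.of K))⦄ (f : Y ⟶ X) (g : Z ⟶ Y) (hf : S f) :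
      (splitTorus K n).map g.op (y f hf) = y (g ≫ f) (S.downward_closed hf g) := (hx f g hf).symm
  have hcoord (i : Fin n) := section_glue hS
    (fun Y f hf => (torusCoord (y f hf) i : globalAlgebra K Y)) fun Y Z f g hf => by
      rw [← hy f g hf]; rfl
  have hcoord_inv (i : Fin n) := section_glue hS
    (fun Y f hf => (↑(torusCoord (y f hf) i)⁻¹ : globalAlgebra K Y)) fun Y Z f g hf => by
      rw [← hy f g hf]; rfl
  choose a ha using hcoord
  choose b hb using hcoord_inv
  have hab (i : Fin n) : a i * b i = 1 := section_ext hS fun Y f hf => by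
    rw [map_mul, ha i f hf, hb i f hf, Units.mul_inv, map_one]
  let t : (splitTorus K n).obj (.op X) :=
    ULift.up fun i => Additive.ofMul (.mkOfMulEqOne (a i) (b i) (hab i) : (globalAlgebra K X)ˣ)
  refine ⟨t, fun Y f hf => splitTorus_ext fun i => ha i f hf, fun t' ht' => ?_⟩
  refine splitTorus_ext fun i => section_ext hS fun Y f hf => ?_
  have ht'f : (splitTorus K n).map f.op t' = y f hf := ht' f hf
  rw [← torusCoord_map, ht'f]
  exact (ha i f hf).symm

end Torus

section Quotient

variable {k B : Type u} [Field k] [CommRing B] [Algebra k B] (A : Subalgebra k B)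

/-- The presheaf `X ↦ (B ⊗ Γ(X, 𝒪_X))ˣ / (A ⊗ Γ(X, 𝒪_X))ˣ`, whose sheafification is
`relativeUnitGroup A`. -/
noncomputable abbrev quotientPresheaf : (Over (Spec (.of k)))ᵒᵖ ⥤ AddCommGrpCat.{u + 1} :=
  globalFunctions k ⋙ naiveQuotient A ⋙ AddCommGrpCat.uliftFunctor.{u + 1, u}

variable {X Y : Over (Spec (.of k))}

/-- The class of a unit of `B ⊗ Γ(X, 𝒪_X)` modulo the units of `A ⊗ Γ(X, 𝒪_X)`. -/
noncomputable def unitClass (u : (B ⊗[k] globalAlgebra k X)ˣ) :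
    (quotientPresheaf A).obj (.op X) :=
  ULift.up (Additive.ofMul (QuotientGroup.mk u))

theorem unitClass_surjective :
    Function.Surjective (unitClass A : _ → (quotientPresheaf A).obj (.op X)) := by
  intro x
  obtain ⟨u, hu⟩ := QuotientGroup.mk_surjective x.down.toMul
  exact ⟨u, ULift.ext _ _ (congrArg Additive.ofMul hu)⟩

theorem quotientPresheaf_map_unitClass (f : Y ⟶ X) (u : (B ⊗[k] globalAlgebra k X)ˣ) :
    (quotientPresheaf A).map f.op (unitClass A u) =
      unitClass A (unitsMap B (globalAlgebraMap k f) u) :=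
  rfl

theorem unitClass_eq_zero_iff {u : (B ⊗[k] globalAlgebra k X)ˣ} :
    unitClass A u = 0 ↔ u ∈ (unitsInclusion A (globalAlgebra k X)).range := by
  rw [← QuotientGroup.eq_one_iff]
  exact ⟨fun h => congrArg (fun x => Additive.toMul (ULift.down x)) h,
    fun h => ULift.ext _ _ (congrArg Additive.ofMul h)⟩

theorem mem_range_tensorInclusion_of_cover {S : Sieve X}
    (hS : S ∈ Scheme.fppfTopology.{u}.over (Spec (.of k)) X) {z : B ⊗[k] globalAlgebra k X}
    (h : ∀ ⦃Y : Over (Spec (.of k))⦄ (f : Y ⟶ X), S f →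
      Algebra.TensorProduct.map (AlgHom.id k B) (globalAlgebraMap k f) z ∈
        (tensorInclusion A (globalAlgebra k Y)).range) :
    z ∈ (tensorInclusion A (globalAlgebra k X)).range := by
  rw [mem_range_tensorInclusion_iff_rTensor_mkQ]
  refine lTensor_ext hS fun Y f hf => ?_
  rw [← LinearMap.comp_apply, LinearMap.lTensor_comp_rTensor, ← LinearMap.rTensor_comp_lTensor]
  exact (mem_range_tensorInclusion_iff_rTensor_mkQ A).mp (h f hf)

theorem quotientPresheaf_eq_zero_of_cover {S : Sieve X}
    (hS : S ∈ Scheme.fppfTopology.{u}.over (Spec (.of k)) X)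
    {x : (quotientPresheaf A).obj (.op X)}
    (h : ∀ ⦃Y : Over (Spec (.of k))⦄ (f : Y ⟶ X), S f → (quotientPresheaf A).map f.op x = 0) :
    x = 0 := by
  obtain ⟨u, rfl⟩ := unitClass_surjective A x
  simp_rw [quotientPresheaf_map_unitClass, unitClass_eq_zero_iff,
    mem_range_unitsInclusion_iff] at h
  rw [unitClass_eq_zero_iff, mem_range_unitsInclusion_iff]
  exact ⟨mem_range_tensorInclusion_of_cover A hS fun Y f hf => (h f hf).1,
    mem_range_tensorInclusion_of_cover A hS fun Y f hf => (h f hf).2⟩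

/-- The homomorphism from the naive quotient to the quotient sheaf. -/
noncomputable abbrev toRelativeUnitGroup : quotientPresheaf A ⟶ (relativeUnitGroup A).obj :=
  toSheafify (Scheme.fppfTopology.{u}.over (Spec (.of k))) (quotientPresheaf A)

instance : Presheaf.IsLocallyInjective (Scheme.fppfTopology.{u}.over (Spec (.of k)))
    (toRelativeUnitGroup A) :=
  inferInstanceAs (Presheaf.IsLocallyInjective _ (toSheafify _ (quotientPresheaf A)))

instance : Presheaf.IsLocallySurjective (Scheme.fppfTopology.{u}.over (Spec (.of k)))
    (toRelativeUnitGroup A) :=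
  inferInstanceAs (Presheaf.IsLocallySurjective _ (toSheafify _ (quotientPresheaf A)))

theorem toRelativeUnitGroup_app_injective (X : (Over (Spec (.of k)))ᵒᵖ) :
    Function.Injective ((toRelativeUnitGroup A).app X) := by
  refine (injective_iff_map_eq_zero ((toRelativeUnitGroup A).app X).hom).mpr fun x hx => ?_
  have hS := Presheaf.equalizerSieve_mem (Scheme.fppfTopology.{u}.over (Spec (.of k)))
    (toRelativeUnitGroup A) x 0 (hx.trans (map_zero _).symm)
  refine quotientPresheaf_eq_zero_of_cover A hS fun Y f hf => ?_
  have hfx : (quotientPresheaf A).map f.op x = (quotientPresheaf A).map f.op 0 := hf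
  rw [hfx, map_zero]

end Quotient

section BaseChange

variable (k K : Type u) [Field k] [Field K] [Algebra k K]

/-- The functor from `K`-schemes to `k`-schemes. -/
noncomputable abbrev restrictBase : Over (Spec (.of K)) ⥤ Over (Spec (.of k)) :=
  Over.map (Spec.map (CommRingCat.ofHom (algebraMap k K)))

theorem structureHom_restrictBase (X : Over (Spec (.of K))) (c : k) :
    structureHom k ((restrictBase k K).obj X) c = structureHom K X (algebraMap k K c) := by
  have h : (Scheme.ΓSpecIso (.of k)).inv ≫
      (X.hom ≫ Spec.map (CommRingCat.ofHom (algebraMap k K))).appTop =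
      CommRingCat.ofHom (algebraMap k K) ≫ (Scheme.ΓSpecIso (.of K)).inv ≫ X.hom.appTop := by
    rw [Scheme.Hom.comp_appTop, Scheme.ΓSpecIso_inv_naturality_assoc]
  exact congrArg (fun f => f.hom c) h

noncomputable instance (X : Over (Spec (.of K))) :
    Algebra K (globalAlgebra k ((restrictBase k K).obj X)) :=
  inferInstanceAs (Algebra K (globalAlgebra K X))

instance (X : Over (Spec (.of K))) :
    IsScalarTower k K (globalAlgebra k ((restrictBase k K).obj X)) :=
  .of_algebraMap_eq (structureHom_restrictBase k K X)

variable {K}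

/-- The homomorphism of `K`-algebras of global functions induced by a morphism of `K`-schemes,
with the global functions formed over `k`. -/
noncomputable def globalAlgebraMapRestrictBase {X Y : Over (Spec (.of K))} (f : X ⟶ Y) :
    globalAlgebra k ((restrictBase k K).obj Y) →ₐ[K] globalAlgebra k ((restrictBase k K).obj X) :=
  globalAlgebraMap K f

end BaseChange

section SpecOver

variable (K R : Type u) [Field K] [CommRing R] [Algebra K R]

/-- The spectrum of a `K`-algebra, as a `K`-scheme. -/
noncomputable abbrev specOver : Over (Spec (.of K)) :=
  Over.mk (Spec.map (CommRingCat.ofHom (algebraMap K R)))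

/-- The isomorphism `R ≅ Γ(Spec R, 𝒪)`. -/
noncomputable def globalAlgebraSpecOver : R ≃ₐ[K] globalAlgebra K (specOver K R) :=
  .ofRingEquiv (f := (Scheme.ΓSpecIso (.of R)).symm.commRingCatIsoToRingEquiv) fun c =>
    congrArg (fun f => f.hom c)
      (Scheme.ΓSpecIso_inv_naturality (CommRingCat.ofHom (algebraMap K R)))

variable {K R} {S : Type u} [CommRing S] [Algebra K S]

/-- The morphism of spectra induced by a homomorphism of `K`-algebras. -/
noncomputable def specOverMap (φ : R →ₐ[K] S) : specOver K S ⟶ specOver K R :=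
  Over.homMk (Spec.map (CommRingCat.ofHom φ.toRingHom)) <| by
    refine (Spec.map_comp _ _).symm.trans ?_
    rw [← CommRingCat.ofHom_comp]
    exact congrArg (fun f => Spec.map (CommRingCat.ofHom f)) φ.comp_algebraMap

theorem globalAlgebraMap_specOverMap (φ : R →ₐ[K] S) (r : R) :
    globalAlgebraMap K (specOverMap φ) (globalAlgebraSpecOver K R r) =
      globalAlgebraSpecOver K S (φ r) :=
  (congrArg (fun f => f.hom r)
    (Scheme.ΓSpecIso_inv_naturality (CommRingCat.ofHom φ.toRingHom))).symm

variable (K R) in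
/-- The isomorphism `R ≅ Γ(Spec R, 𝒪)` of `k`-algebras, for a `K`-algebra `R`. -/
noncomputable def globalAlgebraRestrictBaseSpecOver (k : Type u) [Field k] [Algebra k K]
    [Algebra k R] [IsScalarTower k K R] :
    R ≃ₐ[k] globalAlgebra k ((restrictBase k K).obj (specOver K R)) :=
  AlgEquiv.restrictScalars k (S := K)
    (B := globalAlgebra k ((restrictBase k K).obj (specOver K R))) (globalAlgebraSpecOver K R)

end SpecOver

section TorusEmbedding

variable {k B : Type u} [Field k] [CommRing B] [Algebra k B] (A : Subalgebra k B)
  (K : Type u) [Field K] [Algebra k K]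

/-- A homomorphism from `R ↦ (B ⊗ R)ˣ` to the split torus of rank `n`, natural in the `K`-algebra
`R`, whose kernel is `R ↦ (A ⊗ R)ˣ`. -/
structure TorusEmbedding (n : ℕ) where
  toHom (R : Type u) [CommRing R] [Algebra k R] [Algebra K R] [IsScalarTower k K R] :
    (B ⊗[k] R)ˣ →* (Fin n → Rˣ)
  ker_toHom (R : Type u) [CommRing R] [Algebra k R] [Algebra K R] [IsScalarTower k K R] :
    (toHom R).ker = (unitsInclusion A R).range
  toHom_unitsMap {R S : Type u} [CommRing R] [Algebra k R] [Algebra K R] [IsScalarTower k K R]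
    [CommRing S] [Algebra k S] [Algebra K S] [IsScalarTower k K S] (φ : R →ₐ[K] S)
    (u : (B ⊗[k] R)ˣ) (i : Fin n) :
    (toHom S (unitsMap B (φ.restrictScalars k) u) i : S) = φ (toHom R u i)

variable {A K}

@[simp]
theorem coe_unitsMap {R S : Type u} [CommRing R] [Algebra k R] [CommRing S] [Algebra k S]
    (φ : R →ₐ[k] S) (u : (B ⊗[k] R)ˣ) :
    (unitsMap B φ u : B ⊗[k] S) = Algebra.TensorProduct.map (AlgHom.id k B) φ u :=
  rfl

theorem unitsMap_unitsMap {R S T : Type u} [CommRing R] [Algebra k R] [CommRing S] [Algebra k S]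
    [CommRing T] [Algebra k T] (ψ : S →ₐ[k] T) (φ : R →ₐ[k] S) (u : (B ⊗[k] R)ˣ) :
    unitsMap B ψ (unitsMap B φ u) = unitsMap B (ψ.comp φ) u :=
  Units.ext (DFunLike.congr_fun (f := (Algebra.TensorProduct.map (AlgHom.id k B) ψ).comp
    (Algebra.TensorProduct.map (AlgHom.id k B) φ)) (by ext <;> simp) (u : B ⊗[k] R))

theorem unitsMap_id {R : Type u} [CommRing R] [Algebra k R] (u : (B ⊗[k] R)ˣ) :
    unitsMap B (AlgHom.id k R) u = u :=
  Units.ext (DFunLike.congr_fun (Algebra.TensorProduct.map_id (S := k)) (u : B ⊗[k] R))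

theorem unitsMap_mem_range_unitsInclusion_iff {R S : Type u} [CommRing R] [Algebra k R]
    [CommRing S] [Algebra k S] (e : R ≃ₐ[k] S) {u : (B ⊗[k] R)ˣ} :
    unitsMap B e.toAlgHom u ∈ (unitsInclusion A S).range ↔ u ∈ (unitsInclusion A R).range := by
  refine ⟨fun h => ?_, fun h => range_le_comap A _ h⟩
  have hu : unitsMap B e.symm.toAlgHom (unitsMap B e.toAlgHom u) = u := by
    rw [unitsMap_unitsMap]
    exact (congrArg (unitsMap B · u) e.symm_comp).trans (unitsMap_id u)
  exact hu ▸ range_le_comap A _ h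

section NatTrans

variable {n : ℕ} (θ : (restrictBase k K).op ⋙ quotientPresheaf A ⟶ splitTorus K n)

/-- The homomorphism `(B ⊗ Γ(X, 𝒪_X))ˣ → (Γ(X, 𝒪_X)ˣ)ⁿ` that is given by a morphism of presheaves
from the naive quotient to the split torus. -/
noncomputable def natTransHom (X : Over (Spec (.of K))) :
    (B ⊗[k] globalAlgebra k ((restrictBase k K).obj X))ˣ →* (Fin n → (globalAlgebra K X)ˣ) :=
  .mk' (fun u => torusCoord (θ.app (.op X) (unitClass A u))) fun u v =>
    congrArg torusCoord (map_add (θ.app (.op X)).hom (unitClass A u) (unitClass A v))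

theorem ker_natTransHom {X : Over (Spec (.of K))} (hθ : Function.Injective (θ.app (.op X))) :
    (natTransHom θ X).ker = (unitsInclusion A _).range := by
  ext u
  rw [← unitClass_eq_zero_iff, ← map_eq_zero_iff (θ.app (.op X)).hom hθ]
  exact ⟨fun h => splitTorus_ext fun i => congrArg Units.val (congrFun h i),
    fun h => congrArg torusCoord h⟩

theorem natTransHom_unitsMap {X Y : Over (Spec (.of K))} (f : Y ⟶ X)
    (u : (B ⊗[k] globalAlgebra k ((restrictBase k K).obj X))ˣ) (i : Fin n) :
    (natTransHom θ Y (unitsMap B (globalAlgebraMap k ((restrictBase k K).map f)) u) i :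
      globalAlgebra K Y) = globalAlgebraMap K f (natTransHom θ X u i : globalAlgebra K X) := by
  have hnat := NatTrans.naturality_apply θ f.op (unitClass A u)
  exact congrArg (fun t => (torusCoord t i : globalAlgebra K Y)) hnat

end NatTrans

namespace TorusEmbedding

variable {n : ℕ}

/-- The values on affine schemes of an embedding of the naive quotient in the split torus. -/
noncomputable def ofNatTrans
    (θ : (restrictBase k K).op ⋙ quotientPresheaf A ⟶ splitTorus K n)
    (hθ : ∀ X, Function.Injective (θ.app X)) : TorusEmbedding A K n where
  toHom R _ _ _ _ :=
    ((Units.map (globalAlgebraSpecOver K R).symm.toRingHom.toMonoidHom).compLeft (Fin n)).comp <|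
      (natTransHom θ (specOver K R)).comp
        (unitsMap B (globalAlgebraRestrictBaseSpecOver K R k).toAlgHom)
  ker_toHom R _ _ _ _ := by
    ext u
    rw [← unitsMap_mem_range_unitsInclusion_iff (globalAlgebraRestrictBaseSpecOver K R k),
      ← ker_natTransHom θ (hθ _)]
    have hinj : Function.Injective
        ((Units.map (globalAlgebraSpecOver K R).symm.toRingHom.toMonoidHom).compLeft (Fin n)) :=
      (Units.map_injective (globalAlgebraSpecOver K R).symm.injective).comp_left
    exact map_eq_one_iff _ hinj
  toHom_unitsMap {R S} _ _ _ _ _ _ _ _ φ u i := by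
    refine (globalAlgebraSpecOver K S).symm_apply_eq.mpr ?_
    have hu : unitsMap B (globalAlgebraRestrictBaseSpecOver K S k).toAlgHom
        (unitsMap B (φ.restrictScalars k) u) =
        unitsMap B (globalAlgebraMap k ((restrictBase k K).map (specOverMap φ)))
          (unitsMap B (globalAlgebraRestrictBaseSpecOver K R k).toAlgHom u) := by
      rw [unitsMap_unitsMap, unitsMap_unitsMap]
      exact congrArg (unitsMap B · u)
        (AlgHom.ext fun r => (globalAlgebraMap_specOverMap φ r).symm)
    rw [← globalAlgebraMap_specOverMap]
    refine (congrArg (fun v => (natTransHom θ (specOver K S) v i).val) hu).trans ?_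
    refine (natTransHom_unitsMap θ (specOverMap φ) _ i).trans ?_
    exact congrArg (globalAlgebraMap K (specOverMap φ))
      ((globalAlgebraSpecOver K R).apply_symm_apply _).symm

/-- The morphism of presheaves from the naive quotient to the split torus that is given by a torus
embedding. -/
noncomputable def toNatTrans (τ : TorusEmbedding A K n) :
    (restrictBase k K).op ⋙ quotientPresheaf A ⟶ splitTorus K n where
  app X := AddCommGrpCat.ofHom <|
    (AddEquiv.ulift.symm.toAddMonoidHom.comp
      (MonoidHom.toAdditive (QuotientGroup.lift _
        (τ.toHom (globalAlgebra k ((restrictBase k K).obj X.unop))) (τ.ker_toHom _).ge))).comp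
          AddEquiv.ulift.toAddMonoidHom
  naturality X Y f := by
    refine AddCommGrpCat.hom_ext (AddMonoidHom.ext fun x => ?_)
    obtain ⟨u, rfl⟩ := unitClass_surjective A x
    exact splitTorus_ext fun i =>
      τ.toHom_unitsMap (globalAlgebraMapRestrictBase k f.unop) u i

end TorusEmbedding

end TorusEmbedding

section Criterion

variable {k B : Type u} [Field k] [CommRing B] [Algebra k B] {A : Subalgebra k B}

theorem exists_torusEmbedding_of_isTorus (h : IsTorus (relativeUnitGroup A)) :
    ∃ n, Nonempty (TorusEmbedding A (AlgebraicClosure k) n) := by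
  obtain ⟨n, ⟨e⟩⟩ := h
  let θ := Functor.whiskerLeft (restrictBase k (AlgebraicClosure k)).op (toRelativeUnitGroup A)
  refine ⟨n, ⟨.ofNatTrans (θ ≫ e.hom) fun X => ?_⟩⟩
  exact (ConcreteCategory.bijective_of_isIso (e.hom.app X)).1.comp
    (toRelativeUnitGroup_app_injective A _)

namespace TorusEmbedding

variable {n : ℕ}

theorem toNatTrans_app_bijective {K : Type u} [Field K] [Algebra k K] (τ : TorusEmbedding A K n)
    (hτ : ∀ (R : Type u) [CommRing R] [Algebra k R] [Algebra K R] [IsScalarTower k K R],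
      Function.Surjective (τ.toHom R)) (X : (Over (Spec (.of K)))ᵒᵖ) :
    Function.Bijective (τ.toNatTrans.app X) := by
  constructor
  · refine (injective_iff_map_eq_zero (τ.toNatTrans.app X).hom).mpr fun x hx => ?_
    obtain ⟨u, rfl⟩ := unitClass_surjective A x
    rw [unitClass_eq_zero_iff, ← τ.ker_toHom]
    exact congrArg torusCoord hx
  · intro t
    obtain ⟨u, hu⟩ := hτ (globalAlgebra k ((restrictBase k K).obj X.unop)) (torusCoord t)
    exact ⟨unitClass A u, splitTorus_ext fun i => congrArg Units.val (congrFun hu i)⟩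

theorem isTorus (τ : TorusEmbedding A (AlgebraicClosure k) n)
    (hτ : ∀ (R : Type u) [CommRing R] [Algebra k R] [Algebra (AlgebraicClosure k) R]
      [IsScalarTower k (AlgebraicClosure k) R], Function.Surjective (τ.toHom R)) :
    IsTorus (relativeUnitGroup A) := by
  have hiso (X) : IsIso (τ.toNatTrans.app X) :=
    (ConcreteCategory.isIso_iff_bijective _).mpr (τ.toNatTrans_app_bijective hτ X)
  have : IsIso τ.toNatTrans := (NatTrans.isIso_iff_isIso_app _).mpr hiso
  let F := restrictBase k (AlgebraicClosure k)
  let J := Scheme.fppfTopology.{u}.over (Spec (.of (AlgebraicClosure k)))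
  let J' := Scheme.fppfTopology.{u}.over (Spec (.of k))
  let P : Sheaf J AddCommGrpCat.{u + 1} := ⟨F.op ⋙ quotientPresheaf A,
    (Presheaf.isSheaf_of_iso_iff (asIso τ.toNatTrans)).mpr (isSheaf_splitTorus _ n)⟩
  let G : Sheaf J AddCommGrpCat.{u + 1} :=
    ⟨F.op ⋙ (relativeUnitGroup A).obj, F.op_comp_isSheaf J J' (relativeUnitGroup A)⟩
  let η : P ⟶ G := ⟨Functor.whiskerLeft F.op (toRelativeUnitGroup A)⟩
  have : IsIso η := (Sheaf.isLocallyBijective_iff_isIso η).mp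
    ⟨Presheaf.isLocallyInjective_whisker J J' F (toRelativeUnitGroup A),
      Presheaf.isLocallySurjective_whisker J J' F (toRelativeUnitGroup A)⟩
  exact ⟨n, ⟨(asIso ((sheafToPresheaf _ _).map η)).symm ≪≫ asIso τ.toNatTrans⟩⟩

end TorusEmbedding

end Criterion

section Characters

variable {k B K : Type u} [Field k] [CommRing B] [Algebra k B] {A : Subalgebra k B} [Field K]
  [Algebra k K]

theorem evalUnits_unitsMap {R S : Type u} [CommRing R] [Algebra k R] [Algebra K R]
    [IsScalarTower k K R] [CommRing S] [Algebra k S] [Algebra K S] [IsScalarTower k K S]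
    (φ : R →ₐ[K] S) (u : (B ⊗[k] R)ˣ) :
    evalUnits K B S (unitsMap B (φ.restrictScalars k) u) =
      Units.map φ.toRingHom.toMonoidHom ∘ evalUnits K B R u :=
  funext fun χ => Units.ext (evalAt_map_right χ φ u)

variable [IsSepClosed K] [Algebra.Etale k (B ⧸ nilradical B)] {n : ℕ}

namespace TorusEmbedding

/-- The torus embedding given by the ratios of values at characters `B → K` with the same
restriction to `A`. -/
noncomputable def ofCharacters (hA : (nilradical B : Set B) ⊆ A)
    (e : Fin n ≃ {χ : B →ₐ[k] K // fiberBase (fun χ => χ.comp A.val) χ ≠ χ}) :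
    TorusEmbedding A K n where
  toHom R _ _ _ _ := (MulEquiv.arrowCongr e.symm (.refl Rˣ)).toMonoidHom.comp
    ((fiberRatio _ Rˣ).comp (evalUnits K B R))
  ker_toHom R _ _ _ _ := by
    ext u
    rw [mem_range_unitsInclusion_iff_factorsThrough K hA, ← fiberRatio_eq_one_iff,
      MonoidHom.mem_ker, MonoidHom.comp_apply, MonoidHom.comp_apply]
    exact (MulEquiv.arrowCongr e.symm (.refl Rˣ)).map_eq_one_iff
  toHom_unitsMap {R S} _ _ _ _ _ _ _ _ φ u i := by
    have hratio := fiberRatio_comp (f := fun χ : B →ₐ[k] K => χ.comp A.val)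
      (Units.map φ.toRingHom.toMonoidHom) (evalUnits K B R u)
    rw [← evalUnits_unitsMap] at hratio
    exact congrArg Units.val (congrFun hratio (e i))

theorem ofCharacters_toHom_surjective (hA : (nilradical B : Set B) ⊆ A)
    (e : Fin n ≃ {χ : B →ₐ[k] K // fiberBase (fun χ => χ.comp A.val) χ ≠ χ})
    (R : Type u) [CommRing R] [Algebra k R] [Algebra K R] [IsScalarTower k K R] :
    Function.Surjective ((ofCharacters hA e).toHom R) :=
  (MulEquiv.arrowCongr e.symm (.refl Rˣ)).surjective.comp
    ((fiberRatio_surjective _ Rˣ).comp (evalUnits_surjective K B R))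

end TorusEmbedding

end Characters

theorem isTorus_relativeUnitGroup {k B : Type u} [Field k] [CommRing B] [Algebra k B]
    {A : Subalgebra k B} [Algebra.Etale k (B ⧸ nilradical B)]
    (hA : (nilradical B : Set B) ⊆ A) : IsTorus (relativeUnitGroup A) := by
  have : Module.Finite k (B ⧸ nilradical B) := Algebra.FormallyUnramified.finite_of_free k _
  have : Finite (B →ₐ[k] AlgebraicClosure k) :=
    .of_equiv _ (reductionCharacter (AlgebraicClosure k) B).symm
  let e := (Finite.equivFin {χ : B →ₐ[k] AlgebraicClosure k //
    fiberBase (fun χ => χ.comp A.val) χ ≠ χ}).symm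
  exact (TorusEmbedding.ofCharacters hA e).isTorus
    (TorusEmbedding.ofCharacters_toHom_surjective hA e)

section Rigidity

variable {k B K : Type u} [Field k] [CommRing B] [Algebra k B] {A : Subalgebra k B} [Field K]
  [Algebra k K] {n : ℕ}

open Polynomial

theorem lTensor_lcoeff_one_map_CAlgHom_mul_X (z : B ⊗[k] K) :
    ((lcoeff K 1).restrictScalars k).lTensor B
      (Algebra.TensorProduct.map (AlgHom.id k B) (CAlgHom (R := k) (A := K)) z * 1 ⊗ₜ X) = z := by
  induction z with
  | zero => simp
  | add z w hz hw => rw [map_add, add_mul, map_add, hz, hw]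
  | tmul b c => simp

namespace TorusEmbedding

variable (τ : TorusEmbedding A K n)
include τ

theorem mem_range_unitsInclusion_of_unitsMap_aeval_zero {u : (B ⊗[k] K[X])ˣ}
    (hu : unitsMap B ((aeval (0 : K)).restrictScalars k) u = 1) :
    u ∈ (unitsInclusion A K[X]).range := by
  rw [← τ.ker_toHom, MonoidHom.mem_ker]
  refine funext fun i => Units.ext ?_
  obtain ⟨c, -, hc⟩ := isUnit_iff.mp (τ.toHom K[X] u i).isUnit
  have heval := τ.toHom_unitsMap (aeval (0 : K)) u i
  rw [hu, map_one, ← hc, aeval_C] at heval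
  rw [← hc, ← show (1 : K) = c from heval, C_1]
  rfl

theorem mem_range_tensorInclusion_of_isNilpotent {z : B ⊗[k] K} (hz : IsNilpotent z) :
    z ∈ (tensorInclusion A K).range := by
  let w : B ⊗[k] K[X] :=
    Algebra.TensorProduct.map (AlgHom.id k B) (CAlgHom (R := k) (A := K)) z * 1 ⊗ₜ X
  have hw : IsUnit (1 + w) :=
    ((Commute.all _ _).isNilpotent_mul_right (hz.map _)).isUnit_one_add
  have hmem : 1 + w ∈ (tensorInclusion A K[X]).range := by
    refine ((mem_range_unitsInclusion_iff A).mp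
      (τ.mem_range_unitsInclusion_of_unitsMap_aeval_zero (u := hw.unit) (Units.ext ?_))).1
    simp [w]
  have hw_mem : w ∈ (tensorInclusion A K[X]).range := by simpa using sub_mem hmem (one_mem _)
  rw [← lTensor_lcoeff_one_map_CAlgHom_mul_X z]
  exact lTensor_mem_range_tensorInclusion A _ hw_mem

end TorusEmbedding

end Rigidity

section Differential

variable {k B K : Type u} [Field k] [CommRing B] [Algebra k B] {A : Subalgebra k B} [Field K]
  [Algebra k K]

/-- The map `z ↦ zε` from `B ⊗ K` to `B ⊗ K[ε]`. -/
noncomputable def tensorEps : B ⊗[k] K →ₗ[k] B ⊗[k] DualNumber K :=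
  ((TrivSqZeroExt.inrHom K K).restrictScalars k).lTensor B

theorem tensorEps_mul_tensorEps (z w : B ⊗[k] K) : tensorEps z * tensorEps w = 0 := by
  induction z with
  | zero => rw [map_zero, zero_mul]
  | add z₁ z₂ h₁ h₂ => rw [map_add, add_mul, h₁, h₂, add_zero]
  | tmul b c =>
    induction w with
    | zero => rw [map_zero, mul_zero]
    | add w₁ w₂ h₁ h₂ => rw [map_add, mul_add, h₁, h₂, add_zero]
    | tmul b' c' => simp [tensorEps]

theorem lTensor_sndHom_tensorEps (z : B ⊗[k] K) :
    ((TrivSqZeroExt.sndHom K K).restrictScalars k).lTensor B (tensorEps z) = z := by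
  rw [tensorEps, ← LinearMap.comp_apply, ← LinearMap.lTensor_comp]
  exact LinearMap.lTensor_id_apply _ _ _

theorem map_fstHom_tensorEps (z : B ⊗[k] K) :
    Algebra.TensorProduct.map (AlgHom.id k B)
      ((TrivSqZeroExt.fstHom K K K).restrictScalars k) (tensorEps z) = 0 := by
  induction z with
  | zero => rw [map_zero, map_zero]
  | add z w hz hw => rw [map_add, map_add, hz, hw, add_zero]
  | tmul b c => simp [tensorEps]

/-- The endomorphism `ε ↦ cε` of the dual numbers. -/
noncomputable def scaleEps (c : K) : DualNumber K →ₐ[K] DualNumber K :=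
  TrivSqZeroExt.map (c • LinearMap.id)

theorem map_scaleEps_tensorEps (c : K) (z : B ⊗[k] K) :
    Algebra.TensorProduct.map (AlgHom.id k B) ((scaleEps c).restrictScalars k) (tensorEps z) =
      tensorEps ((LinearMap.mulLeft k c).lTensor B z) := by
  induction z with
  | zero => simp only [map_zero]
  | add z w hz hw => simp only [map_add, hz, hw]
  | tmul b d => exact congrArg (b ⊗ₜ ·) (TrivSqZeroExt.map_inr (c • LinearMap.id) d)

/-- The homomorphism `z ↦ 1 + zε` from `B ⊗ K` onto the tangent space of `B ⊗ K` at `1`. -/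
noncomputable def oneAddEps : Multiplicative (B ⊗[k] K) →* (B ⊗[k] DualNumber K)ˣ :=
  MonoidHom.toHomUnits
    { toFun z := 1 + tensorEps z.toAdd
      map_one' := by simp
      map_mul' z w := by
        rw [toAdd_mul, map_add, add_mul, mul_add, mul_add, tensorEps_mul_tensorEps]
        ring }

@[simp]
theorem coe_oneAddEps (z : Multiplicative (B ⊗[k] K)) :
    (oneAddEps z : B ⊗[k] DualNumber K) = 1 + tensorEps z.toAdd :=
  rfl

theorem unitsMap_fstHom_oneAddEps (z : Multiplicative (B ⊗[k] K)) :
    unitsMap B ((TrivSqZeroExt.fstHom K K K).restrictScalars k) (oneAddEps z) = 1 := by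
  refine Units.ext ?_
  rw [coe_unitsMap, coe_oneAddEps, map_add, map_one, map_fstHom_tensorEps, add_zero, Units.val_one]

theorem unitsMap_scaleEps_oneAddEps (c : K) (z : B ⊗[k] K) :
    unitsMap B ((scaleEps c).restrictScalars k) (oneAddEps (.ofAdd z)) =
      oneAddEps (.ofAdd ((LinearMap.mulLeft k c).lTensor B z)) := by
  refine Units.ext ?_
  rw [coe_unitsMap, coe_oneAddEps, coe_oneAddEps, map_add, map_one, toAdd_ofAdd, toAdd_ofAdd,
    map_scaleEps_tensorEps]

namespace TorusEmbedding

variable {n : ℕ} (τ : TorusEmbedding A K n)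

theorem fst_toHom_oneAddEps (z : Multiplicative (B ⊗[k] K)) (i : Fin n) :
    (τ.toHom (DualNumber K) (oneAddEps z) i : DualNumber K).fst = 1 := by
  have hfst := τ.toHom_unitsMap (TrivSqZeroExt.fstHom K K K) (oneAddEps z) i
  rw [unitsMap_fstHom_oneAddEps, map_one] at hfst
  exact hfst.symm

/-- The differential at `1` of a torus embedding. -/
noncomputable def differential : K ⊗[k] B →ₗ[K] (Fin n → K) where
  toFun x i := (τ.toHom (DualNumber K)
    (oneAddEps (.ofAdd (TensorProduct.comm k K B x))) i : DualNumber K).snd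
  map_add' x y := by
    ext i
    simp [ofAdd_add, fst_toHom_oneAddEps, add_comm]
  map_smul' c x := by
    have hsmul : TensorProduct.comm k K B (c • x) =
        (LinearMap.mulLeft k c).lTensor B (TensorProduct.comm k K B x) := by
      induction x with
      | zero => simp
      | add x y hx hy => rw [smul_add, map_add, hx, hy, ← map_add, ← map_add]
      | tmul d b => simp [TensorProduct.smul_tmul']
    ext i
    rw [hsmul, ← unitsMap_scaleEps_oneAddEps, τ.toHom_unitsMap]
    simp [scaleEps]

theorem ker_differential_le :
    LinearMap.ker τ.differential ≤
      LinearMap.ker ((Subalgebra.toSubmodule A).mkQ.baseChange K) := by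
  intro x hx
  have hker : τ.toHom (DualNumber K) (oneAddEps (.ofAdd (TensorProduct.comm k K B x))) = 1 :=
    funext fun i => Units.ext <|
      TrivSqZeroExt.ext (τ.fst_toHom_oneAddEps _ i) (congrFun hx i)
  rw [← MonoidHom.mem_ker, τ.ker_toHom, mem_range_unitsInclusion_iff] at hker
  have heps : tensorEps (TensorProduct.comm k K B x) ∈
      (tensorInclusion A (DualNumber K)).range := by
    simpa using sub_mem hker.1 (one_mem _)
  have hmem := lTensor_mem_range_tensorInclusion A
    ((TrivSqZeroExt.sndHom K K).restrictScalars k) heps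
  rw [lTensor_sndHom_tensorEps, mem_range_tensorInclusion_iff_rTensor_mkQ] at hmem
  rw [LinearMap.mem_ker, LinearMap.baseChange_eq_ltensor,
    ← LinearMap.comm_comp_rTensor_comp_comm_eq]
  exact (congrArg (TensorProduct.comm k _ K) hmem).trans (map_zero _)

include τ in
theorem finite_quotient_toSubmodule : Module.Finite k (B ⧸ Subalgebra.toSubmodule A) := by
  have hsurj : Function.Surjective ((Subalgebra.toSubmodule A).mkQ.baseChange K) :=
    LinearMap.lTensor_surjective K (Submodule.mkQ_surjective _)
  have : Module.Finite K ((K ⊗[k] B) ⧸ LinearMap.ker τ.differential) :=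
    .equiv τ.differential.quotKerEquivRange.symm
  have : Module.Finite K (K ⊗[k] (B ⧸ Subalgebra.toSubmodule A)) :=
    .of_surjective ((LinearMap.ker τ.differential).liftQ _ τ.ker_differential_le)
      (Function.Surjective.of_comp (g := (LinearMap.ker τ.differential).mkQ) hsurj)
  exact Module.Finite.of_finite_tensorProduct_of_faithfullyFlat K

end TorusEmbedding

end Differential

section Torus

variable {k B : Type u} [Field k] [CommRing B] [Algebra k B] {A : Subalgebra k B}

theorem nilradical_tensorProduct_le_of_isTorus (h : IsTorus (relativeUnitGroup A)) :
    nilradical (B ⊗[k] AlgebraicClosure k) ≤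
      (conductorIdeal A).map (algebraMap B (B ⊗[k] AlgebraicClosure k)) := by
  obtain ⟨n, ⟨τ⟩⟩ := exists_torusEmbedding_of_isTorus h
  exact le_map_conductorIdeal_of_subset A fun z hz => τ.mem_range_tensorInclusion_of_isNilpotent hz

theorem nilradical_le_conductorIdeal_of_isTorus (h : IsTorus (relativeUnitGroup A)) :
    nilradical B ≤ conductorIdeal A := by
  rw [← (conductorIdeal A).comap_map_eq_self_of_faithfullyFlat (B := B ⊗[k] AlgebraicClosure k),
    ← Ideal.map_le_iff_le_comap]
  exact (map_nilradical_le _).trans (nilradical_tensorProduct_le_of_isTorus h)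

theorem etale_quotient_nilradical_of_isTorus (h : IsTorus (relativeUnitGroup A))
    (hA : conductorIdeal A ≤ nilradical B) : Algebra.Etale k (B ⧸ nilradical B) := by
  obtain ⟨n, ⟨τ⟩⟩ := exists_torusEmbedding_of_isTorus h
  have := τ.finite_quotient_toSubmodule
  have := finite_quotient_conductorIdeal A
  have : Module.Finite k (B ⧸ nilradical B) :=
    .of_surjective (Ideal.Quotient.factorₐ k hA).toLinearMap (Ideal.Quotient.factor_surjective hA)
  have : IsReduced ((B ⧸ nilradical B) ⊗[k] AlgebraicClosure k) :=
    isReduced_quotient_nilradical_tensorProduct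
      ((nilradical_tensorProduct_le_of_isTorus h).trans (Ideal.map_mono hA))
  rw [etale_iff_isGeometricallyReduced, Algebra.isGeometricallyReduced_field_iff]
  exact isReduced_of_injective
    (Algebra.TensorProduct.comm k (AlgebraicClosure k) (B ⧸ nilradical B))
    (Algebra.TensorProduct.comm k _ _).injective

theorem le_nilradical_of_isNilpotent {C : Type*} [CommRing C] {𝔞 : Ideal C} (h : IsNilpotent 𝔞) :
    𝔞 ≤ nilradical C := by
  obtain ⟨n, hn⟩ := h
  exact fun b hb => ⟨n, by simpa [hn] using Ideal.pow_mem_pow hb n⟩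

end Torus

end RelativeUnits

open RelativeUnits

theorem mainTheorem4_general {k B : Type u} [Field k] [CommRing B] [Algebra k B]
    (A : Subalgebra k B) :
    (IsTorus (relativeUnitGroup A) →
      Subtype.val '' (nilradical A : Set A) = (nilradical B : Set B)) ∧
    (Subtype.val '' (nilradical A : Set A) = (nilradical B : Set B) ∧
        Algebra.Etale k (B ⧸ nilradical B) →
      IsTorus (relativeUnitGroup A) ∧ Algebra.Etale k (A ⧸ nilradical A)) ∧
    ((∀ 𝔞 : Ideal B, (𝔞 : Set B) ⊆ A → 𝔞 ≤ nilradical B) →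
      (IsTorus (relativeUnitGroup A) ↔
        Subtype.val '' (nilradical A : Set A) = (nilradical B : Set B) ∧
          Algebra.Etale k (B ⧸ nilradical B))) := by
  simp only [image_val_nilradical_eq_iff]
  have hnil (h : IsTorus (relativeUnitGroup A)) : (nilradical B : Set B) ⊆ A :=
    fun _ hb => conductorIdeal_subset A (nilradical_le_conductorIdeal_of_isTorus h hb)
  refine ⟨hnil, fun ⟨hA, _⟩ => ?_, fun hc => ⟨fun h => ?_, fun ⟨hA, _⟩ => ?_⟩⟩
  · exact ⟨isTorus_relativeUnitGroup hA, etale_quotient_nilradical_subalgebra A⟩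
  · have hconductor : conductorIdeal A ≤ nilradical B := hc _ (conductorIdeal_subset A)
    exact ⟨hnil h, etale_quotient_nilradical_of_isTorus h hconductor⟩
  · exact isTorus_relativeUnitGroup hA

theorem mainTheorem4 {k B : Type u} [Field k] [CommRing B] [Algebra k B] [Module.Finite k B]
    (A : Subalgebra k B) :
    (RelativeUnits.IsTorus (RelativeUnits.relativeUnitGroup A) →
      Subtype.val '' (nilradical A : Set A) = (nilradical B : Set B)) ∧
    (Subtype.val '' (nilradical A : Set A) = (nilradical B : Set B) ∧
        Algebra.Etale k (B ⧸ nilradical B) →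
      RelativeUnits.IsTorus (RelativeUnits.relativeUnitGroup A) ∧
        Algebra.Etale k (A ⧸ nilradical A)) ∧
    ((∀ 𝔞 : Ideal B, (𝔞 : Set B) ⊆ (A : Set B) → IsNilpotent 𝔞) →
      (RelativeUnits.IsTorus (RelativeUnits.relativeUnitGroup A) ↔
        Subtype.val '' (nilradical A : Set A) = (nilradical B : Set B) ∧
          Algebra.Etale k (B ⧸ nilradical B))) :=
  have ⟨ha, hb, hc⟩ := mainTheorem4_general A
  ⟨ha, hb, fun h => hc fun 𝔞 h𝔞 => le_nilradical_of_isNilpotent (h 𝔞 h𝔞)⟩
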